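/- Let $N,k,l\in\mathbb{N}=\{0,1,2,\dots\}$, $\mathbb{R}_+=(0,\infty)$, and for $u\in\mathbb{R}^N$ let $\Delta_N(u)=\prod_{1\le i<j\le N}(u_j-u_i)$. Let $\alpha:\mathbb{R}\to\mathbb{C}$ be a function, let $\lambda=(\lambda_1,\dots,\lambda_l)$ be pairwise distinct complex numbers, and let $\kappa=(\kappa_1,\dots,\kappa_k)$ be pairwise distinct elements of $\mathbb{C}\setminus[0,\infty)$. Assume that $\alpha$ is suitably integrable in the sense that $$\int_0^\infty z^{n}\,\left|\alpha(z)\,\frac{\prod_{i=1}^l(z-\lambda_i)}{\prod_{i=1}^k(z-\kappa_i)}\right|dz<\infty\qquad (n=0,1,\dots,N-1)$$ (the functions $z\mapsto z^n\alpha(z)\prod_{i=1}^l(z-\lambda_i)/\prod_{i=1}^k(z-\kappa_i)$ being measurable). Define the partition function of the Bures-like ensemble $$Z^{(N,\mathrm B)}_{k|l}[\alpha](\kappa,\lambda)=\frac1{N!}\int_{\mathbb{R}_+^N}\frac{\Delta_N^2(z)}{\prod_{1\le i<j\le N}(z_i+z_j)}\prod_{j=1}^N\alpha(z_j)\frac{\prod_{i=1}^l(z_j-\lambda_i)}{\prod_{i=1}^k(z_j-\kappa_i)}\,d[z]$$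 and the partition function of the Cauchy-like two-matrix ensemble, with weights $\alpha(x)$ and $\alpha(y)y$, $$Z^{(N,\mathrm C)}_{k|l;k|l}[\alpha](\kappa,\lambda;\kappa,\lambda)=\frac1{(N!)^2}\int_{\mathbb{R}_+^{2N}}\frac{\Delta_N^2(x)\,\Delta_N^2(y)}{\prod_{i,j=1}^N(x_i+y_j)}\prod_{j=1}^N\left(\alpha(x_j)\,\alpha(y_j)\,y_j\,\frac{\prod_{i=1}^l(x_j-\lambda_i)(y_j-\lambda_i)}{\prod_{i=1}^k(x_j-\kappa_i)(y_j-\kappa_i)}\right)d[x]\,d[y].$$ Then both integrals converge absolutely, and $$\left(Z^{(N,\mathrm B)}_{k|l}[\alpha](\kappa,\lambda)\right)^2=2^N\,Z^{(N,\mathrm C)}_{k|l;k|l}[\alpha](\kappa,\lambda;\kappa,\lambda).$$ -/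

import Mathlib

open MeasureTheory

noncomputable section

/-- The Vandermonde determinant `Δ_N(u) = det [u_a ^ (b-1)] = ∏_{i<j} (u_j - u_i)`. -/
def vandermondeDet {N : ℕ} (u : Fin N → ℝ) : ℝ := (Matrix.vandermonde u).det

/-- The open positive orthant `ℝ₊^N`, the domain of integration. -/
def positiveOrthant (N : ℕ) : Set (Fin N → ℝ) := {z | ∀ j, 0 < z j}

/-- The one-point factor `∏_{i=1}^l (z - lam_i) / ∏_{i=1}^k (z - κ_i)`. -/
def charRatio {k l : ℕ} (κ : Fin k → ℂ) (lam : Fin l → ℂ) (z : ℝ) : ℂ :=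
  (∏ i, ((z : ℂ) - lam i)) / ∏ i, ((z : ℂ) - κ i)

/-- The integrand of the partition function of the Bures-like ensemble. -/
def buresIntegrand {N k l : ℕ} (α : ℝ → ℂ) (κ : Fin k → ℂ) (lam : Fin l → ℂ)
    (z : Fin N → ℝ) : ℂ :=
  ((vandermondeDet z ^ 2 / ∏ i, ∏ j ∈ Finset.Ioi i, (z i + z j) : ℝ) : ℂ) *
    ∏ j, (α (z j) * charRatio κ lam (z j))

/-- The partition function `Z^{(N,B)}_{k|l}[α](κ, lam)` of the Bures-like ensemble. -/
def buresPartition (N : ℕ) {k l : ℕ} (α : ℝ → ℂ) (κ : Fin k → ℂ) (lam : Fin l → ℂ) : ℂ :=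
  1 / (N.factorial : ℂ) * ∫ z in positiveOrthant N, buresIntegrand α κ lam z

/-- The integrand of the partition function of the Cauchy-like two-matrix ensemble; the one-point
weights are `α(x)` for the first and `α(y) y` for the second set of variables. -/
def cauchyIntegrand {N k₁ l₁ k₂ l₂ : ℕ} (α : ℝ → ℂ)
    (κ₁ : Fin k₁ → ℂ) (lam₁ : Fin l₁ → ℂ) (κ₂ : Fin k₂ → ℂ) (lam₂ : Fin l₂ → ℂ)
    (p : (Fin N → ℝ) × (Fin N → ℝ)) : ℂ :=
  ((vandermondeDet p.1 ^ 2 * vandermondeDet p.2 ^ 2 /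
      ∏ i, ∏ j, (p.1 i + p.2 j) : ℝ) : ℂ) *
    ∏ j, (α (p.1 j) * (α (p.2 j) * (p.2 j : ℂ)) *
      (charRatio κ₁ lam₁ (p.1 j) * charRatio κ₂ lam₂ (p.2 j)))

/-- The partition function `Z^{(N,C)}_{k₁|l₁;k₂|l₂}[α](κ₁, lam₁; κ₂, lam₂)` of the Cauchy-like
two-matrix ensemble. -/
def cauchyPartition (N : ℕ) {k₁ l₁ k₂ l₂ : ℕ} (α : ℝ → ℂ)
    (κ₁ : Fin k₁ → ℂ) (lam₁ : Fin l₁ → ℂ) (κ₂ : Fin k₂ → ℂ) (lam₂ : Fin l₂ → ℂ) : ℂ :=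
  1 / (N.factorial : ℂ) ^ 2 *
    ∫ p in positiveOrthant N ×ˢ positiveOrthant N, cauchyIntegrand α κ₁ lam₁ κ₂ lam₂ p

/-- Suitable integrability of the one-point weight `α` for given `N`, `κ` and `lam`: the moments of
order `0, …, N - 1` of the weight `α(z) ∏ (z - lam_i) / ∏ (z - κ_i)` on `ℝ₊` converge
absolutely. -/
def SuitableWeight (N : ℕ) {k l : ℕ} (α : ℝ → ℂ) (κ : Fin k → ℂ) (lam : Fin l → ℂ) : Prop :=
  ∀ n < N, IntegrableOn (fun z : ℝ => (z : ℂ) ^ n * (α z * charRatio κ lam z)) (Set.Ioi 0)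

end

/-!
A function `f` on lists is read as an alternating form, so that the Pfaffian of a kernel `ω` is the
exponential `e ^ ω`, and `e ^ ω ∧ (1 + m)` treats even and odd numbers of points alike. If
`ω u = m u • p`, then contracting with `u` sends `e ^ ω ∧ (1 + m)` to
`m u • e ^ (ω + p ∧ m) ∧ (1 + p)`. This pivot step is used twice:

* for `ω x y = (y - x) / (x + y)` and `m = 1`, the new kernel is the old one rescaled by `ω u`,
  which gives Schur's Pfaffian `∏ (z j - z i) / (z i + z j)`;
* for general `ω` and `m`, it matches one step of Gaussian elimination on `m ⊗ m + ω`, which gives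
  `(e ^ ω ∧ (1 + m)) ^ 2 = det (m ⊗ m + ω)`.

By Schur's Pfaffian and de Bruijn's integration formula, the Bures partition function is
`e ^ ω ∧ (1 + m)` for the moments `m` and the bimoments `ω` of the kernel `(y - x) / (x + y)`. By
Cauchy's determinant and Andréief's formula, the Cauchy partition function is the determinant of the
bimoments of the kernel `y / (x + y)`. The two are linked by
`1 + (y - x) / (x + y) = 2 * y / (x + y)`, which turns `m ⊗ m + ω` into twice the second bimoments.
-/

section Pfaffian

variable {X K : Type*} [CommRing K]

/-- Exterior multiplication by the one-form `q` on functions of lists: `f` is read as an alternating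
form whose value at `k` vectors is its value at lists of length `k`. -/
def wedge : (X → K) →ₗ[K] (List X → K) →ₗ[K] List X → K :=
  LinearMap.mk₂ K
    (fun q f v => ∑ i : Fin v.length, (-1) ^ (i : ℕ) * q v[i] * f (v.eraseIdx i))
    (fun q q' f => by ext v; simp [mul_add, add_mul, Finset.sum_add_distrib])
    (fun c q f => by ext v; simp [Finset.mul_sum, mul_assoc, mul_left_comm])
    (fun q f g => by ext v; simp [mul_add, Finset.sum_add_distrib])
    (fun c q f => by ext v; simp [Finset.mul_sum, mul_assoc, mul_left_comm])

theorem wedge_apply (q : X → K) (f : List X → K) (v : List X) :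
    wedge q f v = ∑ i : Fin v.length, (-1) ^ (i : ℕ) * q v[i] * f (v.eraseIdx i) :=
  rfl

theorem wedge_nil (q : X → K) (f : List X → K) : wedge q f [] = 0 := by
  simp [wedge_apply]

theorem wedge_cons (q : X → K) (f : List X → K) (x : X) (v : List X) :
    wedge q f (x :: v) = q x * f v - wedge q (fun w => f (x :: w)) v := by
  rw [wedge_apply, wedge_apply]
  change ∑ i : Fin (v.length + 1), _ = _
  rw [Fin.sum_univ_succ, sub_eq_add_neg, ← Finset.sum_neg_distrib]
  simp [pow_succ]

theorem wedge_congr (q : X → K) {f g : List X → K} {v : List X}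
    (h : ∀ w, w.length < v.length → f w = g w) : wedge q f v = wedge q g v := by
  rw [wedge_apply, wedge_apply]
  refine Finset.sum_congr rfl fun i _ => ?_
  have hlt : (v.eraseIdx i).length < v.length := by
    rw [List.length_eraseIdx_of_lt i.2]
    have := i.2
    omega
  rw [h _ hlt]

theorem wedge_wedge_self (q : X → K) (f : List X → K) : wedge q (wedge q f) = 0 := by
  ext v
  induction v generalizing f with
  | nil => exact wedge_nil _ _
  | cons x v ih =>
    have hcons : (fun w => wedge q f (x :: w)) = q x • f - wedge q fun w => f (x :: w) := by
      ext w
      exact wedge_cons q f x w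
    rw [wedge_cons, hcons, map_sub, map_smul, Pi.sub_apply, ih, Pi.smul_apply, smul_eq_mul,
      Pi.zero_apply, sub_zero, sub_self, Pi.zero_apply]

theorem wedge_wedge_comm (p q : X → K) (f : List X → K) :
    wedge p (wedge q f) = -wedge q (wedge p f) := by
  have h := wedge_wedge_self (p + q) f
  simp only [map_add, LinearMap.add_apply, wedge_wedge_self, zero_add, add_zero] at h
  exact eq_neg_of_add_eq_zero_right h

/-- The Pfaffian of the matrix `ω v[i] v[j]`, `i < j`, expanded along its first row; it vanishes on
lists of odd length. -/
def pfaffian (ω : X → X → K) : List X → K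
  | [] => 1
  | x :: v => ∑ i : Fin v.length, (-1) ^ (i : ℕ) * ω x v[i] * pfaffian ω (v.eraseIdx i)
termination_by v => v.length
decreasing_by
  rw [List.length_eraseIdx_of_lt i.2, List.length_cons]
  omega

theorem pfaffian_nil (ω : X → X → K) : pfaffian ω [] = 1 := by
  rw [pfaffian]

theorem pfaffian_cons (ω : X → X → K) (x : X) (v : List X) :
    pfaffian ω (x :: v) = wedge (ω x) (pfaffian ω) v := by
  rw [pfaffian, wedge_apply]

/-- `pfaffian ω` is the exponential of the two-form `ω`, and the square of `p ∧ m` vanishes. -/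
theorem pfaffian_add_wedge (ω : X → X → K) (p m : X → K) :
    pfaffian (fun x y => ω x y + p x * m y - m x * p y) =
      pfaffian ω + wedge p (wedge m (pfaffian ω)) := by
  set ω' : X → X → K := fun x y => ω x y + p x * m y - m x * p y
  have hrow (x : X) : ω' x = ω x + p x • m - m x • p := rfl
  have hcons (x : X) : (fun w => wedge m (pfaffian ω) (x :: w)) =
      m x • pfaffian ω - wedge m (wedge (ω x) (pfaffian ω)) := by
    ext w
    simp only [wedge_cons, pfaffian_cons]
    rfl
  have hcomm (q : X → K) : wedge q (wedge p (wedge m (pfaffian ω))) =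
      wedge p (wedge m (wedge q (pfaffian ω))) := by
    rw [wedge_wedge_comm q p, wedge_wedge_comm q m, map_neg, neg_neg]
  have hzero : wedge p (wedge m (wedge p (pfaffian ω))) = 0 := by
    rw [← hcomm, wedge_wedge_self]
  ext v
  induction hn : v.length using Nat.strong_induction_on generalizing v with
  | _ n ih =>
    cases v with
    | nil => simp [pfaffian_nil, wedge_nil]
    | cons x v =>
      have hlt : ∀ w : List X, w.length < v.length →
          pfaffian ω' w = (pfaffian ω + wedge p (wedge m (pfaffian ω))) w :=
        fun w hw => ih _ (by simp only [← hn, List.length_cons]; omega) w rfl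
      rw [pfaffian_cons, wedge_congr _ hlt, hrow, Pi.add_apply, pfaffian_cons, wedge_cons, hcons]
      simp only [map_add, map_sub, map_smul, LinearMap.add_apply, LinearMap.sub_apply,
        LinearMap.smul_apply, hcomm, hzero, wedge_wedge_self, map_zero, Pi.add_apply, Pi.sub_apply,
        Pi.smul_apply, Pi.zero_apply, smul_eq_mul]
      ring

/-- On lists of even length this is the Pfaffian of `ω`, and on lists of odd length the Pfaffian of
`ω` bordered by the row `m`; one formula covers both parities. -/
def borderedPfaffian (ω : X → X → K) (m : X → K) (v : List X) : K :=
  pfaffian ω v + wedge m (pfaffian ω) v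

theorem borderedPfaffian_nil (ω : X → X → K) (m : X → K) : borderedPfaffian ω m [] = 1 := by
  simp [borderedPfaffian, pfaffian_nil, wedge_nil]

theorem borderedPfaffian_cons_of_row_eq {ω : X → X → K} {m p : X → K} {u : X}
    (h : ∀ x, ω u x = m u * p x) (v : List X) :
    borderedPfaffian ω m (u :: v) =
      m u * borderedPfaffian (fun x y => ω x y + p x * m y - m x * p y) p v := by
  have hrow : ω u = m u • p := funext h
  have hcons : (fun w => pfaffian ω (u :: w)) = m u • wedge p (pfaffian ω) := by
    ext w
    rw [pfaffian_cons, hrow, map_smul, LinearMap.smul_apply]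
  simp only [borderedPfaffian, pfaffian_add_wedge, map_add, wedge_wedge_self, add_zero]
  rw [wedge_cons, hcons, pfaffian_cons, hrow, map_smul, map_smul, wedge_wedge_comm m p]
  simp only [LinearMap.smul_apply, Pi.add_apply, Pi.smul_apply, Pi.neg_apply, smul_eq_mul]
  ring

theorem mul_prod_map_eraseIdx (g : X → K) (v : List X) (i : Fin v.length) :
    g v[i] * ((v.eraseIdx i).map g).prod = (v.map g).prod := by
  rw [← List.eraseIdx_map,
    ← List.CommMonoid.mul_prod_eraseIdx (l := v.map g) (i := i) (by simp), List.getElem_map]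
  rfl

theorem pfaffian_of_mul_mul {ω ω' : X → X → K} {g : X → K} {v : List X}
    (h : ∀ x ∈ v, ∀ y ∈ v, ω' x y = g x * g y * ω x y) :
    pfaffian ω' v = (v.map g).prod * pfaffian ω v := by
  induction hn : v.length using Nat.strong_induction_on generalizing v with
  | _ n ih =>
    cases v with
    | nil => simp [pfaffian_nil]
    | cons x v =>
      rw [pfaffian_cons, pfaffian_cons, wedge_apply, wedge_apply, Finset.mul_sum]
      refine Finset.sum_congr rfl fun i _ => ?_
      have hmem {y : X} (hy : y ∈ v.eraseIdx i) : y ∈ x :: v :=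
        List.mem_cons_of_mem x (List.mem_of_mem_eraseIdx hy)
      have hlt : (v.eraseIdx i).length < n := by
        rw [← hn, List.length_eraseIdx_of_lt i.2, List.length_cons]
        omega
      rw [ih _ hlt (fun a ha b hb => h a (hmem ha) b (hmem hb)) rfl,
        h x List.mem_cons_self v[i] (List.mem_cons_of_mem x (List.getElem_mem _)),
        List.map_cons, List.prod_cons, ← mul_prod_map_eraseIdx g v i]
      ring

theorem borderedPfaffian_of_mul_mul {ω ω' : X → X → K} {g m m' : X → K} {v : List X}
    (h : ∀ x ∈ v, ∀ y ∈ v, ω' x y = g x * g y * ω x y) (hm : ∀ x ∈ v, m' x = g x * m x) :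
    borderedPfaffian ω' m' v = (v.map g).prod * borderedPfaffian ω m v := by
  rw [borderedPfaffian, borderedPfaffian, pfaffian_of_mul_mul h, mul_add, wedge_apply, wedge_apply,
    Finset.mul_sum]
  congr 1
  refine Finset.sum_congr rfl fun i _ => ?_
  have hmem {y : X} (hy : y ∈ v.eraseIdx i) : y ∈ v := List.mem_of_mem_eraseIdx hy
  rw [pfaffian_of_mul_mul fun a ha b hb => h a (hmem ha) b (hmem hb),
    hm v[i] (List.getElem_mem _), ← mul_prod_map_eraseIdx g v i]
  ring

end Pfaffian

section Schur

variable {X K : Type*} [Field K]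

/-- The kernel of Schur's Pfaffian, for points placed in a field by `t`. -/
def schurKernel (t : X → K) (x y : X) : K :=
  (t y - t x) / (t x + t y)

theorem schurKernel_swap (t : X → K) (x y : X) : schurKernel t y x = -schurKernel t x y := by
  rw [schurKernel, schurKernel, add_comm, ← neg_div, neg_sub]

theorem schurKernel_mul_mul {t : X → K} {x y z : X} (hxy : t x + t y ≠ 0) (hzx : t z + t x ≠ 0)
    (hzy : t z + t y ≠ 0) :
    schurKernel t z x * schurKernel t z y * schurKernel t x y =
      schurKernel t x y + schurKernel t z x - schurKernel t z y := by
  simp only [schurKernel]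
  field_simp
  ring

theorem borderedPfaffian_schurKernel_cons {t : X → K} {z : X} {v : List X}
    (hz : ∀ x ∈ v, t z + t x ≠ 0) (hv : ∀ x ∈ v, ∀ y ∈ v, t x + t y ≠ 0) :
    borderedPfaffian (schurKernel t) 1 (z :: v) =
      (v.map (schurKernel t z)).prod * borderedPfaffian (schurKernel t) 1 v := by
  rw [borderedPfaffian_cons_of_row_eq (p := schurKernel t z) (by simp), Pi.one_apply, one_mul]
  refine borderedPfaffian_of_mul_mul (fun x hx y hy => ?_) (by simp)
  rw [schurKernel_mul_mul (hv x hx y hy) (hz x hx) (hz y hy), Pi.one_apply, Pi.one_apply]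
  ring

theorem borderedPfaffian_schurKernel_ofFn {t : X → K} {n : ℕ} {z : Fin n → X}
    (hz : ∀ i j, t (z i) + t (z j) ≠ 0) :
    borderedPfaffian (schurKernel t) 1 (List.ofFn z) =
      ∏ i, ∏ j ∈ Finset.Ioi i, schurKernel t (z i) (z j) := by
  induction n with
  | zero => simp [borderedPfaffian_nil]
  | succ n ih =>
    rw [List.ofFn_succ, borderedPfaffian_schurKernel_cons (by simp [List.mem_ofFn, hz])
      (by simp [List.mem_ofFn, hz]), ih fun i j => hz i.succ j.succ, Fin.prod_univ_succ,
      Fin.prod_Ioi_zero, List.map_ofFn, List.prod_ofFn]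
    simp only [Fin.prod_Ioi_succ, Function.comp_apply]

end Schur

section Determinant

variable {K : Type*}

theorem det_eq_mul_det_sub_div [Field K] {n : ℕ} (M : Matrix (Fin (n + 1)) (Fin (n + 1)) K)
    (h : M 0 0 ≠ 0) :
    M.det = M 0 0 *
      (Matrix.of fun i j : Fin n => M i.succ j.succ - M i.succ 0 * M 0 j.succ / M 0 0).det := by
  let B : Matrix (Fin (n + 1)) (Fin (n + 1)) K :=
    Matrix.of (Fin.cons (M 0) fun i j => M i.succ j - M i.succ 0 / M 0 0 * M 0 j)
  have hB : M.det = B.det := by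
    refine Matrix.det_eq_of_forall_row_eq_smul_add_const
      (Fin.cons 0 fun i => M i.succ 0 / M 0 0) 0 rfl fun i j => ?_
    cases i using Fin.cases <;> simp [B]
  rw [hB, Matrix.det_succ_column_zero, Fin.sum_univ_succ]
  simp [B, h, Matrix.submatrix, div_mul_eq_mul_div]

/-- The restriction `m (v 0) ≠ 0` is removed by continuity along the line `m + t • 1`. -/
theorem borderedPfaffian_ofFn_sq_of_forall_ne_zero [NontriviallyNormedField K] {X : Type*}
    {ω : X → X → K} {n : ℕ} {v : Fin (n + 1) → X}
    (h : ∀ m : X → K, m (v 0) ≠ 0 → borderedPfaffian ω m (List.ofFn v) ^ 2 =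
      (Matrix.of fun i j => m (v i) * m (v j) + ω (v i) (v j)).det) (m : X → K) :
    borderedPfaffian ω m (List.ofFn v) ^ 2 =
      (Matrix.of fun i j => m (v i) * m (v j) + ω (v i) (v j)).det := by
  have hshift (t : K) : borderedPfaffian ω (m + t • 1) (List.ofFn v) =
      borderedPfaffian ω m (List.ofFn v) + t * wedge 1 (pfaffian ω) (List.ofFn v) := by
    simp only [borderedPfaffian, map_add, map_smul, LinearMap.add_apply, LinearMap.smul_apply,
      Pi.add_apply, Pi.smul_apply, smul_eq_mul, add_assoc]
  have hpf : Continuous fun t : K => borderedPfaffian ω (m + t • 1) (List.ofFn v) ^ 2 := by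
    simp only [hshift]
    fun_prop
  have hdet : Continuous fun t : K =>
      (Matrix.of fun i j => (m + t • 1) (v i) * (m + t • 1) (v j) + ω (v i) (v j)).det := by
    refine Continuous.matrix_det (continuous_matrix fun i j => ?_)
    simp only [Matrix.of_apply, Pi.add_apply, Pi.smul_apply, Pi.one_apply]
    fun_prop
  have heq := hpf.ext_on (dense_compl_singleton (-m (v 0))) hdet fun t ht =>
    h _ fun h0 => ht (by simpa [eq_neg_iff_add_eq_zero, add_comm] using h0)
  simpa using congrFun heq 0

theorem borderedPfaffian_ofFn_sq [NontriviallyNormedField K] {X : Type*} {ω : X → X → K}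
    (hself : ∀ x, ω x x = 0) (hswap : ∀ x y, ω y x = -ω x y) (m : X → K) {n : ℕ} (v : Fin n → X) :
    borderedPfaffian ω m (List.ofFn v) ^ 2 =
      (Matrix.of fun i j => m (v i) * m (v j) + ω (v i) (v j)).det := by
  induction n generalizing ω m with
  | zero => simp [borderedPfaffian_nil]
  | succ n ih =>
    refine borderedPfaffian_ofFn_sq_of_forall_ne_zero (fun m hm => ?_) m
    let p : X → K := fun x => ω (v 0) x / m (v 0)
    have hrow (x : X) : ω (v 0) x = m (v 0) * p x := (mul_div_cancel₀ _ hm).symm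
    rw [List.ofFn_succ, borderedPfaffian_cons_of_row_eq hrow, mul_pow,
      ih (fun x => by rw [hself]; ring) (fun x y => by rw [hswap x y]; ring),
      det_eq_mul_det_sub_div _ (by simp [hself, hm])]
    simp only [Matrix.of_apply, hself, add_zero, sq]
    congr 3
    ext i j
    rw [hswap (v 0), hrow, hrow]
    field_simp
    ring

theorem det_inv_add_succ [Field K] {n : ℕ} {x y : Fin (n + 1) → K} (h : ∀ i j, x i + y j ≠ 0) :
    (Matrix.of fun i j => (x i + y j)⁻¹).det =
      (x 0 + y 0)⁻¹ * ((∏ i : Fin n, (x i.succ - x 0) / (x i.succ + y 0)) *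
        ((∏ j : Fin n, (y j.succ - y 0) / (x 0 + y j.succ)) *
          (Matrix.of fun i j : Fin n => (x i.succ + y j.succ)⁻¹).det)) := by
  rw [det_eq_mul_det_sub_div _ (by simp [h]), ← Matrix.det_mul_row, ← Matrix.det_mul_column]
  simp only [Matrix.of_apply]
  congr 3
  ext i j
  have hi0 := h i.succ 0
  have h0j := h 0 j.succ
  have hij := h i.succ j.succ
  field_simp
  ring

theorem det_inv_add_mul_prod_add [Field K] {n : ℕ} {x y : Fin n → K} (h : ∀ i j, x i + y j ≠ 0) :
    (Matrix.of fun i j => (x i + y j)⁻¹).det * ∏ i, ∏ j, (x i + y j) =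
      (Matrix.vandermonde x).det * (Matrix.vandermonde y).det := by
  induction n with
  | zero => simp
  | succ n ih =>
    have ih' := ih (x := Fin.tail x) (y := Fin.tail y) fun i j => h i.succ j.succ
    have hi0 : ∏ i : Fin n, (x i.succ + y 0) ≠ 0 := Finset.prod_ne_zero_iff.2 fun i _ => h i.succ 0
    have h0j : ∏ j : Fin n, (x 0 + y j.succ) ≠ 0 := Finset.prod_ne_zero_iff.2 fun j _ => h 0 j.succ
    have h00 := h 0 0
    simp only [Matrix.det_vandermonde, Fin.tail] at ih'
    simp only [det_inv_add_succ h, Matrix.det_vandermonde, Fin.prod_univ_succ, Fin.prod_Ioi_zero,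
      Fin.prod_Ioi_succ, Finset.prod_mul_distrib, Finset.prod_div_distrib]
    field_simp
    simp only [one_div]
    linear_combination (∏ i : Fin n, (x i.succ - x 0)) * (∏ j : Fin n, (y j.succ - y 0)) * ih'

end Determinant

section Lists

variable {X K : Type*} [CommRing K] {n : ℕ}

theorem eraseIdx_ofFn (z : Fin (n + 1) → X) (j : Fin (n + 1)) :
    (List.ofFn z).eraseIdx j = List.ofFn (j.removeNth z) := by
  refine List.ext_getElem ?_ fun i _ _ => ?_
  · rw [List.length_eraseIdx_of_lt (j.2.trans_eq List.length_ofFn.symm), List.length_ofFn,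
      List.length_ofFn, Nat.add_sub_cancel]
  · simp only [List.getElem_eraseIdx, List.getElem_ofFn, Fin.removeNth_apply, Fin.succAbove,
      Fin.lt_def, Fin.val_castSucc]
    split_ifs <;> rfl

theorem wedge_ofFn (q : X → K) (f : List X → K) (z : Fin (n + 1) → X) :
    wedge q f (List.ofFn z) =
      ∑ j : Fin (n + 1), (-1) ^ (j : ℕ) * q (z j) * f (List.ofFn (j.removeNth z)) := by
  rw [wedge_apply, ← (finCongr (List.length_ofFn (f := z))).sum_comp]
  refine Finset.sum_congr rfl fun i _ => ?_
  simp only [finCongr_apply, ← eraseIdx_ofFn, Fin.getElem_fin, List.getElem_ofFn, Fin.val_cast]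
  rfl

theorem pfaffian_ofFn (ω : X → X → K) (z : Fin (n + 2) → X) :
    pfaffian ω (List.ofFn z) = ∑ j : Fin (n + 1), (-1) ^ (j : ℕ) * ω (z 0) (z j.succ) *
      pfaffian ω (List.ofFn (j.removeNth (Fin.tail z))) := by
  rw [List.ofFn_succ, pfaffian_cons]
  exact wedge_ofFn (ω (z 0)) (pfaffian ω) (Fin.tail z)

end Lists

section HasIntegral

variable {X Y 𝕜 : Type*} [MeasurableSpace X] [MeasurableSpace Y] [RCLike 𝕜]
  {μ : Measure X} {ν : Measure Y} {f : X → 𝕜} {c : 𝕜}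

/-- `f` is integrable and its integral is `c`; unlike an equation `∫ x, f x ∂μ = c`, this cannot
hold through the junk value of a divergent integral. -/
def HasIntegral (f : X → 𝕜) (μ : Measure X) (c : 𝕜) : Prop :=
  Integrable f μ ∧ ∫ x, f x ∂μ = c

theorem hasIntegral_zero : HasIntegral (fun _ => (0 : 𝕜)) μ 0 :=
  ⟨integrable_zero _ _ _, integral_zero _ _⟩

theorem hasIntegral_integral (hf : Integrable f μ) : HasIntegral f μ (∫ x, f x ∂μ) :=
  ⟨hf, rfl⟩

namespace HasIntegral

theorem congr_ae {g : X → 𝕜} (hf : HasIntegral f μ c) (h : f =ᵐ[μ] g) : HasIntegral g μ c :=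
  ⟨hf.1.congr h, (integral_congr_ae h).symm.trans hf.2⟩

theorem const_mul (a : 𝕜) (hf : HasIntegral f μ c) : HasIntegral (fun x => a * f x) μ (a * c) :=
  ⟨hf.1.const_mul a, by rw [integral_const_mul, hf.2]⟩

theorem add {g : X → 𝕜} {d : 𝕜} (hf : HasIntegral f μ c) (hg : HasIntegral g μ d) :
    HasIntegral (fun x => f x + g x) μ (c + d) :=
  ⟨hf.1.add hg.1, by rw [integral_add hf.1 hg.1, hf.2, hg.2]⟩

theorem sum {ι : Type*} [Fintype ι] {f : ι → X → 𝕜} {c : ι → 𝕜}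
    (hf : ∀ i, HasIntegral (f i) μ (c i)) : HasIntegral (fun x => ∑ i, f i x) μ (∑ i, c i) :=
  ⟨integrable_finsetSum _ fun i _ => (hf i).1, by
    rw [integral_finsetSum _ fun i _ => (hf i).1]
    exact Finset.sum_congr rfl fun i _ => (hf i).2⟩

theorem comp {f : Y → 𝕜} {e : X ≃ᵐ Y} (hf : HasIntegral f ν c) (he : MeasurePreserving e μ ν) :
    HasIntegral (fun x => f (e x)) μ c :=
  ⟨(he.integrable_comp_emb e.measurableEmbedding).2 hf.1, (he.integral_comp' f).trans hf.2⟩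

theorem mul_prod [SFinite μ] [SFinite ν] {g : Y → 𝕜} {d : 𝕜} (hf : HasIntegral f μ c)
    (hg : HasIntegral g ν d) : HasIntegral (fun p : X × Y => f p.1 * g p.2) (μ.prod ν) (c * d) :=
  ⟨hf.1.mul_prod hg.1, by rw [integral_prod_mul, hf.2, hg.2]⟩

theorem fintype_prod {ι : Type*} [Fintype ι] [SigmaFinite μ] {f : ι → X → 𝕜} {c : ι → 𝕜}
    (hf : ∀ i, HasIntegral (f i) μ (c i)) :
    HasIntegral (fun z : ι → X => ∏ i, f i (z i)) (Measure.pi fun _ => μ) (∏ i, c i) :=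
  ⟨Integrable.fintype_prod fun i => (hf i).1, by
    rw [integral_fintype_prod_eq_prod]
    exact Finset.prod_congr rfl fun i _ => (hf i).2⟩

theorem mul_removeNth [SigmaFinite μ] {n : ℕ} {g : (Fin n → X) → 𝕜} {d : 𝕜}
    (hf : HasIntegral f μ c) (hg : HasIntegral g (Measure.pi fun _ => μ) d) (j : Fin (n + 1)) :
    HasIntegral (fun z => f (z j) * g (j.removeNth z)) (Measure.pi fun _ => μ) (c * d) :=
  (hf.mul_prod hg).comp (measurePreserving_piFinSuccAbove (fun _ => μ) j)

theorem mul_removeNth_tail [SigmaFinite μ] {n : ℕ} {h : X × X → 𝕜} {g : (Fin n → X) → 𝕜} {d : 𝕜}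
    (hh : HasIntegral h (μ.prod μ) c) (hg : HasIntegral g (Measure.pi fun _ => μ) d)
    (j : Fin (n + 1)) :
    HasIntegral (fun z => h (z 0, z j.succ) * g (j.removeNth (Fin.tail z)))
      (Measure.pi fun _ => μ) (c * d) := by
  have hsplit := ((hh.mul_prod hg).comp
    (measurePreserving_prodAssoc μ μ (Measure.pi fun _ : Fin n => μ)).symm).comp
    (e := (MeasurableEquiv.refl X).prodCongr (MeasurableEquiv.piFinSuccAbove (fun _ => X) j))
    ((MeasurePreserving.id μ).prod (measurePreserving_piFinSuccAbove (fun _ => μ) j))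
  exact hsplit.comp (measurePreserving_piFinSuccAbove (fun _ => μ) 0)

end HasIntegral

end HasIntegral

section DeBruijn

variable {X Y 𝕜 : Type*} [MeasurableSpace X] [MeasurableSpace Y] [RCLike 𝕜]

/-- The bimoment of `φ` and `ψ` with respect to the kernel `k`. -/
noncomputable def bimoment (μ : Measure X) (ν : Measure Y) (k : X → Y → 𝕜) (φ : X → 𝕜)
    (ψ : Y → 𝕜) : 𝕜 :=
  ∫ p, k p.1 p.2 * (φ p.1 * ψ p.2) ∂(μ.prod ν)

theorem bimoment_swap {μ : Measure X} [SFinite μ]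
    {k : X → X → 𝕜} (hk : ∀ x y, k y x = -k x y) (φ ψ : X → 𝕜) :
    bimoment μ μ k ψ φ = -bimoment μ μ k φ ψ := by
  rw [bimoment, bimoment, ← integral_prod_swap, ← integral_neg]
  refine integral_congr_ae (.of_forall fun p => ?_)
  simp only [Prod.fst_swap, Prod.snd_swap]
  rw [hk, mul_comm (ψ _), neg_mul]

theorem hasIntegral_pfaffian_mul_prod {μ : Measure X} [SigmaFinite μ] {k : X → X → 𝕜} {n : ℕ}
    {φ : Fin n → X → 𝕜}
    (hk : ∀ i j, Integrable (fun p : X × X => k p.1 p.2 * (φ i p.1 * φ j p.2)) (μ.prod μ)) :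
    HasIntegral (fun z => pfaffian k (List.ofFn z) * ∏ i, φ i (z i)) (Measure.pi fun _ => μ)
      (pfaffian (bimoment μ μ k) (List.ofFn φ)) := by
  induction n using Nat.twoStepInduction with
  | zero =>
    simpa [pfaffian_nil] using
      HasIntegral.fintype_prod (μ := μ) (f := φ) (c := Fin.elim0) fun i => i.elim0
  | one =>
    simpa [pfaffian_cons, wedge_nil] using hasIntegral_zero
  | more n ih =>
    rw [pfaffian_ofFn]
    have hterm (j : Fin (n + 1)) := ((hasIntegral_integral (hk 0 j.succ)).mul_removeNth_tail
      (ih (φ := j.removeNth (Fin.tail φ)) fun _ _ => hk _ _) j).const_mul ((-1) ^ (j : ℕ))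
    convert HasIntegral.sum hterm using 1
    · ext z
      rw [pfaffian_ofFn, Finset.sum_mul]
      refine Finset.sum_congr rfl fun j _ => ?_
      rw [Fin.prod_univ_succ, Fin.prod_univ_succAbove _ j]
      simp only [Fin.removeNth_apply, Fin.tail]
      ring
    · simp only [mul_assoc]
      rfl

theorem hasIntegral_borderedPfaffian_mul_prod {μ : Measure X} [SigmaFinite μ] {k : X → X → 𝕜}
    {m : X → 𝕜} {n : ℕ} {φ : Fin n → X → 𝕜}
    (hk : ∀ i j, Integrable (fun p : X × X => k p.1 p.2 * (φ i p.1 * φ j p.2)) (μ.prod μ))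
    (hm : ∀ i, Integrable (fun x => m x * φ i x) μ) :
    HasIntegral (fun z => borderedPfaffian k m (List.ofFn z) * ∏ i, φ i (z i))
      (Measure.pi fun _ => μ)
      (borderedPfaffian (bimoment μ μ k) (fun φ => ∫ x, m x * φ x ∂μ) (List.ofFn φ)) := by
  cases n with
  | zero => simpa [borderedPfaffian, wedge_nil] using hasIntegral_pfaffian_mul_prod hk
  | succ n =>
    simp only [borderedPfaffian, add_mul]
    refine (hasIntegral_pfaffian_mul_prod hk).add ?_
    rw [wedge_ofFn]
    have hterm (j : Fin (n + 1)) := ((hasIntegral_integral (hm j)).mul_removeNth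
      (hasIntegral_pfaffian_mul_prod (φ := j.removeNth φ) fun _ _ => hk _ _) j).const_mul
        ((-1) ^ (j : ℕ))
    convert HasIntegral.sum hterm using 1
    · ext z
      rw [wedge_ofFn, Finset.sum_mul]
      refine Finset.sum_congr rfl fun j _ => ?_
      rw [Fin.prod_univ_succAbove _ j]
      simp only [Fin.removeNth_apply]
      ring
    · simp only [mul_assoc]

end DeBruijn

section Alternant

variable {X ι : Type*}

/-- The permutation `z ↦ z ∘ σ` of the coordinates of `ι → X`. -/
def permuteCoords (X : Type*) [MeasurableSpace X] (σ : Equiv.Perm ι) : (ι → X) ≃ᵐ (ι → X) :=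
  (MeasurableEquiv.piCongrLeft (fun _ => X) σ).symm

variable [Fintype ι]

theorem measurePreserving_permuteCoords [MeasurableSpace X] (μ : Measure X) [SigmaFinite μ]
    (σ : Equiv.Perm ι) :
    MeasurePreserving (permuteCoords X σ) (Measure.pi fun _ => μ) (Measure.pi fun _ => μ) :=
  (measurePreserving_piCongrLeft (fun _ => μ) σ).symm

variable [DecidableEq ι]

/-- The Slater determinant `det [φ j (z i)]` of the functions `φ j` at the points `z i`. -/
def alternant {K : Type*} [CommRing K] (φ : ι → X → K) (z : ι → X) : K :=
  (Matrix.of fun i j => φ j (z i)).det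

theorem alternant_eq_sum {K : Type*} [CommRing K] (φ : ι → X → K) (z : ι → X) :
    alternant φ z = ∑ σ, (Equiv.Perm.sign σ : ℤ) * ∏ i, φ i (z (σ i)) :=
  Matrix.det_apply' _

/-- Only the diagonal term of the alternant has to be integrated against an antisymmetric `f`. The
points `x i` are functions on some measure space, on which `T` lifts their permutations. -/
theorem HasIntegral.mul_alternant {W 𝕜 : Type*} [MeasurableSpace W] [RCLike 𝕜] {ρ : Measure W}
    {T : Equiv.Perm ι → W ≃ᵐ W} {x : W → ι → X} {f : W → 𝕜} {φ : ι → X → 𝕜} {c : 𝕜}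
    (hT : ∀ σ, MeasurePreserving (T σ) ρ ρ) (hx : ∀ σ w, x (T σ w) = x w ∘ σ)
    (hf : ∀ σ w, f (T σ w) = (σ.sign : ℤ) * f w)
    (h : HasIntegral (fun w => f w * ∏ i, φ i (x w i)) ρ c) :
    HasIntegral (fun w => f w * alternant φ (x w)) ρ ((Fintype.card ι).factorial * c) := by
  convert HasIntegral.sum fun σ => h.comp (hT σ) using 1
  · ext w
    rw [alternant_eq_sum, Finset.mul_sum]
    refine Finset.sum_congr rfl fun σ _ => ?_
    rw [hf, hx]
    simp only [Function.comp_apply]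
    ring
  · simp [Fintype.card_perm]

end Alternant

section Andreief

variable {X Y 𝕜 ι : Type*} [MeasurableSpace X] [MeasurableSpace Y] [RCLike 𝕜] [Fintype ι]
  [DecidableEq ι] {μ : Measure X} {ν : Measure Y} [SigmaFinite μ] [SigmaFinite ν]
  {k : X → Y → 𝕜} {φ : ι → X → 𝕜} {ψ : ι → Y → 𝕜}

theorem hasIntegral_det_mul_prod_mul_prod
    (hk : ∀ i j, Integrable (fun p : X × Y => k p.1 p.2 * (φ i p.1 * ψ j p.2)) (μ.prod ν)) :
    HasIntegral (fun p : (ι → X) × (ι → Y) => (Matrix.of fun i j => k (p.1 i) (p.2 j)).det *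
        (∏ i, φ i (p.1 i)) * ∏ j, ψ j (p.2 j))
      ((Measure.pi fun _ => μ).prod (Measure.pi fun _ => ν))
      (Matrix.of fun i j => bimoment μ ν k (φ i) (ψ j)).det := by
  have hterm (σ : Equiv.Perm ι) := (((HasIntegral.fintype_prod fun i =>
    hasIntegral_integral (hk (σ i) i)).comp
      (measurePreserving_arrowProdEquivProdArrow X Y ι (fun _ => μ) (fun _ => ν)).symm).comp
      (e := (permuteCoords X σ).prodCongr (MeasurableEquiv.refl _))
      ((measurePreserving_permuteCoords _ σ).prod (MeasurePreserving.id _))).const_mul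
        ((σ.sign : ℤ) : 𝕜)
  convert HasIntegral.sum hterm using 1
  · ext p
    rw [Matrix.det_apply', Finset.sum_mul, Finset.sum_mul]
    refine Finset.sum_congr rfl fun σ _ => ?_
    rw [← Equiv.prod_comp σ fun i => φ i (p.1 i), mul_assoc, mul_assoc, ← Finset.prod_mul_distrib,
      ← Finset.prod_mul_distrib]
    rfl
  · exact Matrix.det_apply' _

theorem hasIntegral_det_mul_alternant_mul_alternant
    (hk : ∀ i j, Integrable (fun p : X × Y => k p.1 p.2 * (φ i p.1 * ψ j p.2)) (μ.prod ν)) :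
    HasIntegral (fun p : (ι → X) × (ι → Y) => (Matrix.of fun i j => k (p.1 i) (p.2 j)).det *
        alternant φ p.1 * alternant ψ p.2)
      ((Measure.pi fun _ => μ).prod (Measure.pi fun _ => ν))
      ((Fintype.card ι).factorial ^ 2 *
        (Matrix.of fun i j => bimoment μ ν k (φ i) (ψ j)).det) := by
  have hprod := hasIntegral_det_mul_prod_mul_prod hk
  simp only [mul_right_comm _ (∏ i, φ i _)] at hprod
  have hfst := hprod.mul_alternant
    (T := fun σ => (permuteCoords X σ).prodCongr (MeasurableEquiv.refl _))
    (fun σ => (measurePreserving_permuteCoords _ σ).prod (MeasurePreserving.id _))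
    (fun _ _ => rfl)
    (fun σ p => by
      rw [← mul_assoc]
      exact congrArg (· * ∏ i, ψ i (p.2 i))
        (Matrix.det_permute σ (Matrix.of fun i j => k (p.1 i) (p.2 j))))
  simp only [mul_right_comm _ (∏ i, ψ i _)] at hfst
  have hsnd := hfst.mul_alternant
    (T := fun σ => (MeasurableEquiv.refl _).prodCongr (permuteCoords Y σ))
    (fun σ => (MeasurePreserving.id _).prod (measurePreserving_permuteCoords _ σ))
    (fun _ _ => rfl)
    (fun σ p => by
      rw [← mul_assoc]
      exact congrArg (· * alternant φ p.1)
        (Matrix.det_permute' σ (Matrix.of fun i j => k (p.1 i) (p.2 j))))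
  simpa only [sq, mul_assoc] using hsnd

end Andreief

section CauchyKernel

variable {X K : Type*} [Field K]

/-- The kernel of the Cauchy ensemble whose second weight carries the factor `y`, for points placed
in a field by `t`. -/
def cauchyKernel (t : X → K) (x y : X) : K :=
  t y / (t x + t y)

theorem schurKernel_eq_two_mul_cauchyKernel_sub_one {t : X → K} {x y : X} (h : t x + t y ≠ 0) :
    schurKernel t x y = 2 * cauchyKernel t x y - 1 := by
  simp only [schurKernel, cauchyKernel]
  field_simp
  ring

theorem det_cauchyKernel {t : X → K} {n : ℕ} {x y : Fin n → X} (h : ∀ i j, t (x i) + t (y j) ≠ 0) :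
    (Matrix.of fun i j => cauchyKernel t (x i) (y j)).det =
      (Matrix.vandermonde (t ∘ x)).det * (Matrix.vandermonde (t ∘ y)).det /
        (∏ i, ∏ j, (t (x i) + t (y j))) * ∏ j, t (y j) := by
  have hprod : ∏ i, ∏ j, (t (x i) + t (y j)) ≠ 0 :=
    Finset.prod_ne_zero_iff.2 fun i _ => Finset.prod_ne_zero_iff.2 fun j _ => h i j
  rw [← det_inv_add_mul_prod_add (x := t ∘ x) (y := t ∘ y) h]
  simp only [Function.comp_apply]
  rw [mul_div_cancel_right₀ _ hprod, mul_comm, ← Matrix.det_mul_row]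
  simp only [cauchyKernel, div_eq_mul_inv, Matrix.of_apply]

end CauchyKernel

section HalfLine

variable {μ : Measure ℝ}

theorem ae_restrict_Ioi_pos : ∀ᵐ x ∂volume.restrict (Set.Ioi (0 : ℝ)), 0 < x :=
  ae_restrict_mem measurableSet_Ioi

theorem ae_prod_pos (hμ : ∀ᵐ x ∂μ, 0 < x) : ∀ᵐ p ∂μ.prod μ, 0 < p.1 ∧ 0 < p.2 :=
  (Measure.quasiMeasurePreserving_fst.ae hμ).and (Measure.quasiMeasurePreserving_snd.ae hμ)

theorem ofReal_add_ofReal_ne_zero {x y : ℝ} (hx : 0 < x) (hy : 0 < y) : (x : ℂ) + y ≠ 0 := by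
  exact_mod_cast (add_pos hx hy).ne'

theorem norm_cauchyKernel_le_one {x y : ℝ} (hx : 0 < x) (hy : 0 < y) :
    ‖cauchyKernel Complex.ofReal x y‖ ≤ 1 := by
  rw [cauchyKernel, ← Complex.ofReal_add, ← Complex.ofReal_div, Complex.norm_real,
    Real.norm_of_nonneg (by positivity), div_le_one (by positivity)]
  linarith

theorem integrable_cauchyKernel_mul (hμ : ∀ᵐ x ∂μ, 0 < x) {φ ψ : ℝ → ℂ} (hφ : Integrable φ μ)
    (hψ : Integrable ψ μ) :
    Integrable (fun p : ℝ × ℝ => cauchyKernel Complex.ofReal p.1 p.2 * (φ p.1 * ψ p.2))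
      (μ.prod μ) := by
  refine (hφ.mul_prod hψ).bdd_mul (c := 1) ?_ ?_
  · unfold cauchyKernel
    exact Measurable.aestronglyMeasurable (by fun_prop)
  · filter_upwards [ae_prod_pos hμ] with p hp using norm_cauchyKernel_le_one hp.1 hp.2

variable [SFinite μ]

theorem hasIntegral_schurKernel_mul (hμ : ∀ᵐ x ∂μ, 0 < x) {φ ψ : ℝ → ℂ} (hφ : Integrable φ μ)
    (hψ : Integrable ψ μ) :
    HasIntegral (fun p : ℝ × ℝ => schurKernel Complex.ofReal p.1 p.2 * (φ p.1 * ψ p.2)) (μ.prod μ)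
      (2 * bimoment μ μ (cauchyKernel Complex.ofReal) φ ψ +
        -1 * ((∫ x, φ x ∂μ) * ∫ x, ψ x ∂μ)) := by
  have h := ((hasIntegral_integral (integrable_cauchyKernel_mul hμ hφ hψ)).const_mul 2).add
    (((hasIntegral_integral hφ).mul_prod (hasIntegral_integral hψ)).const_mul (-1))
  refine h.congr_ae ?_
  filter_upwards [ae_prod_pos hμ] with p hp
  rw [schurKernel_eq_two_mul_cauchyKernel_sub_one (ofReal_add_ofReal_ne_zero hp.1 hp.2)]
  ring

theorem moment_mul_moment_add_bimoment_schurKernel (hμ : ∀ᵐ x ∂μ, 0 < x) {φ ψ : ℝ → ℂ}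
    (hφ : Integrable φ μ) (hψ : Integrable ψ μ) :
    (∫ x, φ x ∂μ) * (∫ x, ψ x ∂μ) + bimoment μ μ (schurKernel Complex.ofReal) φ ψ =
      2 * bimoment μ μ (cauchyKernel Complex.ofReal) φ ψ := by
  rw [bimoment, (hasIntegral_schurKernel_mul hμ hφ hψ).2]
  ring

theorem borderedPfaffian_bimoment_schurKernel_sq (hμ : ∀ᵐ x ∂μ, 0 < x) {n : ℕ}
    {φ : Fin n → ℝ → ℂ} (hφ : ∀ i, Integrable (φ i) μ) :
    borderedPfaffian (bimoment μ μ (schurKernel Complex.ofReal)) (fun φ => ∫ x, φ x ∂μ)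
        (List.ofFn φ) ^ 2 =
      2 ^ n * (Matrix.of fun i j =>
        bimoment μ μ (cauchyKernel Complex.ofReal) (φ i) (φ j)).det := by
  have hswap := bimoment_swap (μ := μ) (schurKernel_swap Complex.ofReal)
  rw [borderedPfaffian_ofFn_sq (fun φ => self_eq_neg.1 (hswap φ φ)) hswap]
  simp only [moment_mul_moment_add_bimoment_schurKernel hμ (hφ _) (hφ _)]
  exact (Matrix.det_smul (Matrix.of fun i j =>
    bimoment μ μ (cauchyKernel Complex.ofReal) (φ i) (φ j)) 2).trans (by rw [Fintype.card_fin])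

theorem hasIntegral_prod_schurKernel_mul_alternant {μ : Measure ℝ} [SigmaFinite μ]
    (hμ : ∀ᵐ x ∂μ, 0 < x) {n : ℕ} {φ : Fin n → ℝ → ℂ} (hφ : ∀ i, Integrable (φ i) μ) :
    HasIntegral (fun z => (∏ i, ∏ j ∈ Finset.Ioi i, schurKernel Complex.ofReal (z i) (z j)) *
        alternant φ z) (Measure.pi fun _ => μ)
      (n.factorial * borderedPfaffian (bimoment μ μ (schurKernel Complex.ofReal))
        (fun φ => ∫ x, φ x ∂μ) (List.ofFn φ)) := by
  have hdiag := hasIntegral_borderedPfaffian_mul_prod (k := schurKernel Complex.ofReal) (m := 1)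
    (fun i j => (hasIntegral_schurKernel_mul hμ (hφ i) (hφ j)).1) (by simpa using hφ)
  have hschur : ∀ᵐ z ∂(Measure.pi fun _ : Fin n => μ),
      borderedPfaffian (schurKernel Complex.ofReal) 1 (List.ofFn z) * ∏ i, φ i (z i) =
        (∏ i, ∏ j ∈ Finset.Ioi i, schurKernel Complex.ofReal (z i) (z j)) * ∏ i, φ i (z i) := by
    filter_upwards [Filter.eventually_all.2 fun i : Fin n =>
      Measure.tendsto_eval_ae_ae.eventually hμ] with z hz
    rw [borderedPfaffian_schurKernel_ofFn fun i j => ofReal_add_ofReal_ne_zero (hz i) (hz j)]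
  simpa using (hdiag.congr_ae hschur).mul_alternant (x := id)
    (fun σ => measurePreserving_permuteCoords μ σ) (fun _ _ => rfl)
    fun σ z => Equiv.Perm.prod_Ioi_comp_eq_sign_mul_prod σ
      fun i j => schurKernel_swap Complex.ofReal (z j) (z i)

end HalfLine

section Ensembles

theorem positiveOrthant_eq_pi (N : ℕ) :
    positiveOrthant N = Set.univ.pi fun _ => Set.Ioi 0 := by
  ext z
  simp [positiveOrthant]

theorem measurableSet_positiveOrthant (N : ℕ) : MeasurableSet (positiveOrthant N) := by
  rw [positiveOrthant_eq_pi]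
  exact MeasurableSet.univ_pi fun _ => measurableSet_Ioi

theorem volume_restrict_positiveOrthant (N : ℕ) :
    volume.restrict (positiveOrthant N) =
      Measure.pi fun _ => volume.restrict (Set.Ioi (0 : ℝ)) := by
  rw [positiveOrthant_eq_pi, volume_pi, Measure.restrict_pi_pi]

/-- The one-point weight of the ensembles, deformed by the characteristic polynomials. -/
noncomputable def deformedWeight {k l : ℕ} (α : ℝ → ℂ) (κ : Fin k → ℂ) (lam : Fin l → ℂ)
    (z : ℝ) : ℂ :=
  α z * charRatio κ lam z

/-- The functions `z ^ j * w z`, `j < N`, whose alternant is the Vandermonde determinant times the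
product of the weights. -/
def weightedMonomials (N : ℕ) (w : ℝ → ℂ) (j : Fin N) (z : ℝ) : ℂ :=
  (z : ℂ) ^ (j : ℕ) * w z

variable {N k l : ℕ} {α : ℝ → ℂ} {κ : Fin k → ℂ} {lam : Fin l → ℂ}

theorem alternant_weightedMonomials (w : ℝ → ℂ) (z : Fin N → ℝ) :
    alternant (weightedMonomials N w) z = (vandermondeDet z : ℂ) * ∏ j, w (z j) := by
  have h : Matrix.of (fun i j => weightedMonomials N w j (z i)) =
      Matrix.of fun i j => w (z i) * (Matrix.vandermonde z).map Complex.ofRealHom i j := by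
    ext i j
    simp [weightedMonomials, mul_comm]
  rw [alternant, h, Matrix.det_mul_column, mul_comm, vandermondeDet, ← Complex.ofRealHom_eq_coe,
    RingHom.map_det]
  rfl

theorem buresIntegrand_eq_mul_alternant (z : Fin N → ℝ) :
    buresIntegrand α κ lam z =
      (∏ i, ∏ j ∈ Finset.Ioi i, schurKernel Complex.ofReal (z i) (z j)) *
        alternant (weightedMonomials N (deformedWeight α κ lam)) z := by
  simp only [buresIntegrand, alternant_weightedMonomials, schurKernel, Finset.prod_div_distrib,
    deformedWeight]
  rw [vandermondeDet, Matrix.det_vandermonde]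
  push_cast
  ring

theorem cauchyIntegrand_eq_mul_alternant {p : (Fin N → ℝ) × (Fin N → ℝ)}
    (hp : p ∈ positiveOrthant N ×ˢ positiveOrthant N) :
    cauchyIntegrand α κ lam κ lam p =
      (Matrix.of fun i j => cauchyKernel Complex.ofReal (p.1 i) (p.2 j)).det *
        alternant (weightedMonomials N (deformedWeight α κ lam)) p.1 *
        alternant (weightedMonomials N (deformedWeight α κ lam)) p.2 := by
  have hvan (x : Fin N → ℝ) :
      (Matrix.vandermonde (Complex.ofReal ∘ x)).det = vandermondeDet x := by
    simp [vandermondeDet, Matrix.det_vandermonde]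
  rw [det_cauchyKernel fun i j => ofReal_add_ofReal_ne_zero (hp.1 i) (hp.2 j), hvan, hvan,
    alternant_weightedMonomials, alternant_weightedMonomials, cauchyIntegrand]
  simp only [Finset.prod_mul_distrib, deformedWeight]
  push_cast
  ring

theorem SuitableWeight.integrable_weightedMonomials (hα : SuitableWeight N α κ lam) (j : Fin N) :
    Integrable (weightedMonomials N (deformedWeight α κ lam) j) (volume.restrict (Set.Ioi 0)) :=
  hα j j.2

theorem SuitableWeight.hasIntegral_buresIntegrand (hα : SuitableWeight N α κ lam) :
    HasIntegral (buresIntegrand α κ lam) (volume.restrict (positiveOrthant N))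
      (N.factorial * borderedPfaffian
        (bimoment (volume.restrict (Set.Ioi 0)) (volume.restrict (Set.Ioi 0))
          (schurKernel Complex.ofReal))
        (fun φ => ∫ x in Set.Ioi 0, φ x)
        (List.ofFn (weightedMonomials N (deformedWeight α κ lam)))) := by
  rw [volume_restrict_positiveOrthant]
  simpa only [← buresIntegrand_eq_mul_alternant] using
    hasIntegral_prod_schurKernel_mul_alternant ae_restrict_Ioi_pos
      hα.integrable_weightedMonomials

theorem SuitableWeight.hasIntegral_cauchyIntegrand (hα : SuitableWeight N α κ lam) :
    HasIntegral (cauchyIntegrand α κ lam κ lam)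
      (volume.restrict (positiveOrthant N ×ˢ positiveOrthant N))
      (N.factorial ^ 2 * (Matrix.of fun i j : Fin N =>
        bimoment (volume.restrict (Set.Ioi 0)) (volume.restrict (Set.Ioi 0))
          (cauchyKernel Complex.ofReal) (weightedMonomials N (deformedWeight α κ lam) i)
          (weightedMonomials N (deformedWeight α κ lam) j)).det) := by
  have h := hasIntegral_det_mul_alternant_mul_alternant fun i j =>
    integrable_cauchyKernel_mul ae_restrict_Ioi_pos
      (hα.integrable_weightedMonomials i) (hα.integrable_weightedMonomials j)
  rw [← volume_restrict_positiveOrthant, Measure.prod_restrict, Fintype.card_fin] at h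
  refine h.congr_ae ?_
  filter_upwards [ae_restrict_mem
    ((measurableSet_positiveOrthant N).prod (measurableSet_positiveOrthant N))] with p hp
  exact (cauchyIntegrand_eq_mul_alternant hp).symm

end Ensembles

theorem mainTheorem1_general (N k l : ℕ) (α : ℝ → ℂ) (κ : Fin k → ℂ) (lam : Fin l → ℂ)
    (hα : SuitableWeight N α κ lam) :
    IntegrableOn (fun z : Fin N → ℝ => buresIntegrand α κ lam z) (positiveOrthant N) ∧
    IntegrableOn (fun p : (Fin N → ℝ) × (Fin N → ℝ) => cauchyIntegrand α κ lam κ lam p)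
      (positiveOrthant N ×ˢ positiveOrthant N) ∧
    buresPartition N α κ lam ^ 2 = 2 ^ N * cauchyPartition N α κ lam κ lam := by
  have hbures := hα.hasIntegral_buresIntegrand
  have hcauchy := hα.hasIntegral_cauchyIntegrand
  refine ⟨hbures.1, hcauchy.1, ?_⟩
  have hN : (N.factorial : ℂ) ≠ 0 := Nat.cast_ne_zero.2 N.factorial_ne_zero
  rw [buresPartition, hbures.2, cauchyPartition, hcauchy.2, one_div, one_div,
    inv_mul_cancel_left₀ hN, inv_mul_cancel_left₀ (pow_ne_zero 2 hN)]
  exact borderedPfaffian_bimoment_schurKernel_sq ae_restrict_Ioi_pos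
    hα.integrable_weightedMonomials

theorem mainTheorem1 (N k l : ℕ) (α : ℝ → ℂ) (κ : Fin k → ℂ) (lam : Fin l → ℂ)
    (hκ : ∀ i, ∀ t : ℝ, 0 ≤ t → κ i ≠ (t : ℂ))
    (hκ_inj : Function.Injective κ) (hlam_inj : Function.Injective lam)
    (hα : SuitableWeight N α κ lam) :
    IntegrableOn (fun z : Fin N → ℝ => buresIntegrand α κ lam z) (positiveOrthant N) ∧
    IntegrableOn (fun p : (Fin N → ℝ) × (Fin N → ℝ) => cauchyIntegrand α κ lam κ lam p)
      (positiveOrthant N ×ˢ positiveOrthant N) ∧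
    buresPartition N α κ lam ^ 2 = 2 ^ N * cauchyPartition N α κ lam κ lam :=
  mainTheorem1_general N k l α κ lam hα
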